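/- Conventions. Signatures are arbitrary (they may be infinite and contain relation, function and constant symbols); $\mathcal A$ and $\mathcal B$ need not have the same signature. For same-length finite tuples $\bar\imath,\bar\jmath$ from a structure $\mathcal M$ write $\bar\imath\sim_{\mathcal M}\bar\jmath$ if they have the same (complete) quantifier-free type over $\emptyset$ in $\mathcal M$. A structure is *locally finite* if all its finitely generated substructures are finite, and *ordered* if some binary relation symbol of its signature is interpreted as a linear order (strict or reflexive) of its underlying set. $\mathcal A$ is a *quantifier-free reduct* of $\mathcal B$ if they have the same underlying set and $\bar\imath\sim_{\mathcal B}\bar\jmath$ implies $\bar\imath\sim_{\mathcal A}\bar\jmath$ for all same-length finite tuples. $\mathcal B$ is *saturated* if it realizes all types in finitely many variables over every subset of its underlying set whose cardinality is less than that of $\mathcal B$. A structure $\mathcal M$ *has RP* (the Ramsey property) if its age $\mathcal K$ (the class of all finitely generated substructures of $\mathcal M$, up to isomorphism) has it: for all $A,B\in\mathcal K$ and all integers $r\ge 2$ there is $C\in\mathcal K$ such that for every coloring with $r$ colors of the set of all substructures of $C$ isomorphic to $A$ there is a substructure $B'\subseteq C$, $B'\cong B$, such that all substructures of $B'$ isomorphic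 to $A$ have the same color. A map $h:\mathcal A\to\mathcal B$ is *qftp-respecting* if $\bar\imath\sim_{\mathcal A}\bar\jmath$ implies $h(\bar\imath)\sim_{\mathcal B}h(\bar\jmath)$ for all same-length finite tuples from $\mathcal A$. $\mathcal A$ is a *semi-retract* of $\mathcal B$ if there are qftp-respecting injections $g:\mathcal A\to\mathcal B$ and $f:\mathcal B\to\mathcal A$ such that $f\circ g:\mathcal A\to\mathcal A$ is an embedding. **Theorem.** Let $\mathcal A$ and $\mathcal B$ be locally finite ordered structures such that $\mathcal A$ is a quantifier-free reduct of $\mathcal B$. Assume that $\mathcal B$ is saturated and that for every finite tuple $\bar a$ from $\mathcal B$ the quantifier-free type of $\bar a$ in $\mathcal B$ is equivalent in $\mathcal B$ to a first-order formula of the signature of $\mathcal B$ without parameters. Suppose that $\mathcal B$ has RP. Then $\mathcal A$ is a semi-retract of $\mathcal B$ if and only if $\mathcal A$ has RP. -/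

import Mathlib

universe u v u' v' w w'

namespace SemiRetract

open FirstOrder FirstOrder.Language

/-- The complete quantifier-free type (over `∅`) of a finite tuple: the set of all
quantifier-free parameter-free formulas that hold of it. -/
def qftp (L : FirstOrder.Language.{u, v}) {M : Type w} [L.Structure M] {n : ℕ} (a : Fin n → M) :
    Set (L.Formula (Fin n)) :=
  {φ | BoundedFormula.IsQF φ ∧ φ.Realize a}

/-- `M` is locally finite: every finitely generated substructure is finite. -/
def IsLocallyFinite (L : FirstOrder.Language.{u, v}) (M : Type w) [L.Structure M] : Prop :=
  ∀ S : L.Substructure M, S.FG → Finite S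

/-- `M` is an ordered structure: some binary relation symbol of the signature is interpreted
in `M` as a linear order on the underlying set. Both readings of a symbol for a linear order,
the strict one (`<`) and the reflexive one (`≤`), are allowed. -/
def IsOrderedStructure (L : FirstOrder.Language.{u, v}) (M : Type w) [L.Structure M] : Prop :=
  ∃ R : L.Relations 2,
    IsStrictTotalOrder M (fun a b => Structure.RelMap R ![a, b]) ∨
      IsLinearOrder M (fun a b => Structure.RelMap R ![a, b])

/-- `M` is `κ`-saturated: for every `S ⊆ M` with `|S| < κ`, all (complete, finitary) types over
`S` in `M`, that is, complete types of the theory of `(M, s)_{s ∈ S}`, are realized in `M`. -/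
def IsSaturatedAt (L : FirstOrder.Language.{u, v}) (M : Type w) [L.Structure M] (κ : Cardinal.{w}) : Prop :=
  ∀ S : Set M, Cardinal.mk S < κ →
    ∀ (n : ℕ) (p : (L[[S]].completeTheory M).CompleteType (Fin n)),
      ∃ a : Fin n → M, ∀ φ : L[[S]].Formula (Fin n), Formula.equivSentence φ ∈ p → φ.Realize a

/-- `M` is saturated: it is `|M|`-saturated. -/
def IsSaturated (L : FirstOrder.Language.{u, v}) (M : Type w) [L.Structure M] : Prop :=
  IsSaturatedAt L M (Cardinal.mk M)

/-- Every quantifier-free type realized in `M` is equivalent in `M` to a parameter-free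
formula. -/
def RealizedQFTypesDefinable (L : FirstOrder.Language.{u, v}) (M : Type w) [L.Structure M] : Prop :=
  ∀ (n : ℕ) (a : Fin n → M), ∃ φ : L.Formula (Fin n),
    ∀ b : Fin n → M, φ.Realize b ↔ ∀ ψ ∈ qftp L a, ψ.Realize b

/-- The copies of `A` in `C`: all substructures of `C` that are isomorphic to `A`. -/
def copies (L : FirstOrder.Language.{u, v}) (C : Type w) [L.Structure C] (A : Type w') [L.Structure A] :
    Set (L.Substructure C) :=
  {A' | Nonempty (A' ≃[L] A)}

/-- The partition arrow `C ⟶ (B)^A_r`: for every `r`-coloring of the copies of `A` in `C` there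
is a copy `B'` of `B` in `C` such that all copies of `A` inside `B'` have the same color. -/
def Arrow (L : FirstOrder.Language.{u, v}) (C B A : Type w) [L.Structure C] [L.Structure B] [L.Structure A]
    (r : ℕ) : Prop :=
  ∀ c : copies L C A → Fin r, ∃ B' ∈ copies L C B,
    ∀ A₁ A₂ : copies L C A, A₁.1 ≤ B' → A₂.1 ≤ B' → c A₁ = c A₂

/-- `(A, B)` is a Ramsey duo for the class `K`. -/
def IsRamseyDuo {L : FirstOrder.Language.{u, v}} (K : Set (CategoryTheory.Bundled.{w} L.Structure))
    (A B : CategoryTheory.Bundled.{w} L.Structure) : Prop :=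
  ∀ r : ℕ, 2 ≤ r → ∃ C ∈ K, Arrow L C B A r

/-- The class `K` has the Ramsey property. -/
def ClassHasRP {L : FirstOrder.Language.{u, v}} (K : Set (CategoryTheory.Bundled.{w} L.Structure)) : Prop :=
  ∀ A ∈ K, ∀ B ∈ K, IsRamseyDuo K A B

/-- The structure `M` has the Ramsey property: its age does. -/
def HasRP (L : FirstOrder.Language.{u, v}) (M : Type w) [L.Structure M] : Prop :=
  ClassHasRP (L.age M)

/-- A map `h : A → B` between structures in possibly different signatures is quantifier-free
type-respecting: it sends finite tuples of the same quantifier-free type to tuples of the same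
quantifier-free type. -/
def QFTypeRespecting (L : FirstOrder.Language.{u, v}) (L' : FirstOrder.Language.{u', v'}) {A : Type w} {B : Type w'}
    [L.Structure A] [L'.Structure B] (h : A → B) : Prop :=
  ∀ (n : ℕ) (i j : Fin n → A), qftp L i = qftp L j → qftp L' (h ∘ i) = qftp L' (h ∘ j)

/-- The `L`-structure `A` is a semi-retract of the `L'`-structure `B`: there are quantifier-free
type-respecting injections `g : A → B` and `f : B → A` such that `f ∘ g` is an embedding of
`L`-structures. -/
def IsSemiRetract (L : FirstOrder.Language.{u, v}) (L' : FirstOrder.Language.{u', v'}) (A : Type w) (B : Type w')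
    [L.Structure A] [L'.Structure B] : Prop :=
  ∃ (g : A → B) (f : B → A), Function.Injective g ∧ Function.Injective f ∧
    QFTypeRespecting L L' g ∧ QFTypeRespecting L' L f ∧
    ∃ e : A ↪[L] A, ∀ x, e x = f (g x)

/-- For an `L`-structure and an `L'`-structure on the same underlying set `M`: the former is a
quantifier-free reduct of the latter, i.e. equality of quantifier-free `L'`-types of finite
tuples refines equality of quantifier-free `L`-types. -/
def IsQFReduct (L : FirstOrder.Language.{u, v}) (L' : FirstOrder.Language.{u', v'}) (M : Type w)
    [L.Structure M] [L'.Structure M] : Prop :=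
  ∀ (n : ℕ) (i j : Fin n → M), qftp L' i = qftp L' j → qftp L i = qftp L j

end SemiRetract

/-! Both directions go through `TupleRP`, which colors index tuples instead of substructures. For
locally finite ordered structures it is equivalent to RP (`HasRP.tupleRP`, `TupleRP.hasRP`), because
the order makes finite substructures rigid. It passes from a structure to its semi-retracts: map the
patterns by `g`, apply Ramsey there, and return by `f`.

Conversely, take `f = id`, which respects types by the reduct hypothesis. What is needed is `g : M →
M` that preserves quantifier-free `LA`-types and sends tuples of equal `LA`-type to tuples of equal
`LB`-type. Saturation and definability leave only finitely many `LB`-types per arity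
(`finite_range_qftp`), so they can serve as colors, and iterated Ramsey gives `g` on every finite
set (`TupleRP.exists_homogeneous`). The conditions on `g` are `LB`-definable, so saturation for
types in `M`-many variables makes `g` global. -/

namespace SemiRetract

open FirstOrder FirstOrder.Language

/-! ### Quantifier-free types and embeddings -/

section QFType

variable {L : FirstOrder.Language.{u, v}} {M : Type w} {N : Type w'} [L.Structure M] [L.Structure N]

theorem realize_iff_of_qftp_eq {n : ℕ} {a : Fin n → M} {b : Fin n → N} (h : qftp L a = qftp L b)
    {φ : L.Formula (Fin n)} (hφ : BoundedFormula.IsQF φ) : φ.Realize a ↔ φ.Realize b := by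
  have : φ ∈ qftp L a ↔ φ ∈ qftp L b := by rw [h]
  simpa [qftp, hφ] using this

theorem qftp_embedding (e : M ↪[L] N) {n : ℕ} (a : Fin n → M) : qftp L (e ∘ a) = qftp L a := by
  ext φ
  refine and_congr_right fun hφ => ?_
  have := hφ.realize_embedding e (v := a) (xs := default)
  rw [Formula.Realize, Formula.Realize, ← this]
  exact iff_of_eq (congrArg _ (Subsingleton.elim _ _))

theorem isQF_formula_relabel {α β : Type*} {φ : L.Formula α} (hφ : BoundedFormula.IsQF φ)
    (g : α → β) : BoundedFormula.IsQF (φ.relabel g) :=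
  BoundedFormula.IsQF.relabel hφ (Sum.inl ∘ g)

theorem qftp_comp {n m : ℕ} {a : Fin n → M} {b : Fin n → N} (h : qftp L a = qftp L b)
    (s : Fin m → Fin n) : qftp L (a ∘ s) = qftp L (b ∘ s) := by
  ext φ
  refine and_congr_right fun hφ => ?_
  rw [← Formula.realize_relabel, ← Formula.realize_relabel]
  exact realize_iff_of_qftp_eq h (isQF_formula_relabel hφ s)

theorem realize_term_eq_iff_of_qftp_eq {n : ℕ} {a : Fin n → M} {b : Fin n → N}
    (h : qftp L a = qftp L b) (t₁ t₂ : L.Term (Fin n)) :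
    t₁.realize a = t₂.realize a ↔ t₁.realize b = t₂.realize b := by
  rw [← Formula.realize_equal, ← Formula.realize_equal]
  exact realize_iff_of_qftp_eq h (BoundedFormula.IsAtomic.equal _ _).isQF

theorem eq_iff_of_qftp_eq {n : ℕ} {a : Fin n → M} {b : Fin n → N}
    (h : qftp L a = qftp L b) (i j : Fin n) : a i = a j ↔ b i = b j :=
  realize_term_eq_iff_of_qftp_eq h (Term.var i) (Term.var j)

theorem relMap_iff_of_qftp_eq {n k : ℕ} {a : Fin n → M} {b : Fin n → N}
    (h : qftp L a = qftp L b) (R : L.Relations k) (t : Fin k → L.Term (Fin n)) :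
    Structure.RelMap R (fun i => (t i).realize a) ↔
      Structure.RelMap R (fun i => (t i).realize b) := by
  rw [← Formula.realize_rel, ← Formula.realize_rel]
  exact realize_iff_of_qftp_eq h (BoundedFormula.IsAtomic.rel _ _).isQF

theorem exists_term_of_closure_eq_top {n : ℕ} {a : Fin n → M}
    (ha : Substructure.closure L (Set.range a) = ⊤) (x : M) :
    ∃ t : L.Term (Fin n), t.realize a = x := by
  obtain ⟨t, rfl⟩ := Substructure.mem_closure_iff_exists_term.1
    (show x ∈ Substructure.closure L (Set.range a) by rw [ha]; trivial)
  choose f hf using fun y : Set.range a => y.2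
  refine ⟨t.relabel f, ?_⟩
  rw [Term.realize_relabel]
  congr 1
  funext y
  exact hf y

/-- If `a` generates `M`, any tuple with the quantifier-free type of `a` is its image under an
embedding of `M`. -/
theorem exists_embedding_of_qftp_eq {n : ℕ} {a : Fin n → M} {b : Fin n → N}
    (h : qftp L a = qftp L b) (ha : Substructure.closure L (Set.range a) = ⊤) :
    ∃ e : M ↪[L] N, ∀ i, e (a i) = b i := by
  choose t ht using exists_term_of_closure_eq_top ha
  refine ⟨⟨⟨fun x => (t x).realize b, ?_⟩, ?_, ?_⟩, ?_⟩
  · intro x y hxy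
    rw [← ht x, ← ht y]
    exact (realize_term_eq_iff_of_qftp_eq h _ _).2 hxy
  · intro k F x
    have := (realize_term_eq_iff_of_qftp_eq h (t (Structure.funMap F x))
      (Term.func F fun i => t (x i))).1 (by simp [ht])
    simpa [Function.comp_def] using this
  · intro k R x
    have := relMap_iff_of_qftp_eq h R fun i => t (x i)
    simp only [ht] at this
    exact this.symm
  · intro i
    exact (realize_term_eq_iff_of_qftp_eq h (t (a i)) (Term.var i)).1 (by simp [ht])

theorem closure_range_subtype_eq_top {n : ℕ} (a : Fin n → M) :
    Substructure.closure L (Set.range fun i => (⟨a i, Substructure.subset_closure ⟨i, rfl⟩⟩ :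
      Substructure.closure L (Set.range a))) = ⊤ := by
  set S := Substructure.closure L (Set.range a)
  refine Substructure.map_injective_of_injective (f := S.subtype.toHom) S.subtype.injective ?_
  rw [Substructure.map_closure, ← Hom.range_eq_map, Substructure.range_subtype, ← Set.range_comp]
  rfl

theorem closure_range_equiv_eq_top {n : ℕ} (e : Fin n ≃ M) :
    Substructure.closure L (Set.range e) = ⊤ := by
  rw [e.range_eq_univ, Substructure.closure_univ]

end QFType

/-! ### Rigidity of finite ordered structures -/

section Rigidity

variable {L : FirstOrder.Language.{u, v}} {M : Type w} [L.Structure M]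

theorem IsOrderedStructure.exists_isStrictTotalOrder (h : IsOrderedStructure L M) :
    ∃ R : L.Relations 2,
      IsStrictTotalOrder M (fun a b => Structure.RelMap R ![a, b] ∧ a ≠ b) := by
  obtain ⟨R, hR | hR⟩ := h
  · refine ⟨R, ?_⟩
    convert hR using 3 with a b
    exact and_iff_left_of_imp fun h hab => irrefl_of (fun a b => Structure.RelMap R ![a, b]) a
      (by simpa [hab] using h)
  · set r : M → M → Prop := fun a b => Structure.RelMap R ![a, b] with hr
    refine ⟨R, { trichotomous := ?_, irrefl := ?_, trans := ?_ }⟩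
    · intro a b h1 h2
      by_contra hab
      rcases total_of r a b with h | h
      exacts [h1 ⟨h, hab⟩, h2 ⟨h, Ne.symm hab⟩]
    · exact fun a h => h.2 rfl
    · intro a b c hab hbc
      refine ⟨trans_of r hab.1 hbc.1, ?_⟩
      rintro rfl
      exact hab.2 (antisymm_of r hab.1 hbc.1)

theorem relMap_and_ne_embedding_iff {A X : Type*} [L.Structure A] [L.Structure X] (f : A ↪[L] X)
    (R : L.Relations 2) (x y : A) :
    (Structure.RelMap R ![f x, f y] ∧ f x ≠ f y) ↔ Structure.RelMap R ![x, y] ∧ x ≠ y := by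
  refine and_congr ?_ f.injective.ne_iff
  rw [← f.map_rel]
  exact iff_of_eq (congrArg _ (by ext i; fin_cases i <;> rfl))

/-- The two embeddings differ by a permutation of `A` preserving the order pulled back from `M`; a
finite linear order has no automorphism but the identity. -/
theorem embedding_eq_of_range_eq (h : IsOrderedStructure L M) {A C : Type*} [L.Structure A]
    [L.Structure C] [Finite A] (ε : C ↪[L] M) (h₁ h₂ : A ↪[L] C)
    (hr : Set.range h₁ = Set.range h₂) (a : A) : h₁ a = h₂ a := by
  obtain ⟨R, hR⟩ := h.exists_isStrictTotalOrder
  let r : A → A → Prop := fun a b => Structure.RelMap R ![a, b] ∧ a ≠ b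
  let e : r ↪r (fun a b : M => Structure.RelMap R ![a, b] ∧ a ≠ b) :=
    ⟨⟨ε.comp h₁, (ε.comp h₁).injective⟩, fun {x y} => relMap_and_ne_embedding_iff (ε.comp h₁) R x y⟩
  have : IsStrictTotalOrder A r := e.isStrictTotalOrder
  have : IsWellOrder A r := { wf := Finite.wellFounded_of_trans_of_irrefl r }
  have hm (x : A) : ∃ y, h₂ y = h₁ x := by
    rw [← Set.mem_range, ← hr]; exact ⟨x, rfl⟩
  choose σ hσ using hm
  have hinj : Function.Injective σ := fun x y hxy => h₁.injective (by rw [← hσ, ← hσ, hxy])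
  let τ : r ≃r r := ⟨Equiv.ofBijective σ (Finite.injective_iff_bijective.1 hinj), fun {x y} => by
    change (Structure.RelMap R ![σ x, σ y] ∧ σ x ≠ σ y) ↔ _
    rw [← relMap_and_ne_embedding_iff h₂, hσ, hσ, relMap_and_ne_embedding_iff h₁]⟩
  have h1 : τ.toInitialSeg = (RelIso.refl r).toInitialSeg := Subsingleton.elim _ _
  have h2 : σ a = a := congrArg (fun f : InitialSeg r r => f a) h1
  rw [← hσ, h2]

end Rigidity

/-! ### The Ramsey property for tuples -/

section Tuples

/-- The Ramsey property for tuples: a tuple `c` can be found such that for every `r`-coloring of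
the `m`-tuples of indices of `c` some subtuple of `c` with the quantifier-free type of `b` has all
its subtuples with the quantifier-free type of `a` of the same color. -/
def TupleRP (L : FirstOrder.Language.{u, v}) (M : Type w) [L.Structure M] : Prop :=
  ∀ (m n : ℕ) (a : Fin m → M) (b : Fin n → M) (r : ℕ), ∃ (N : ℕ) (c : Fin N → M),
    ∀ χ : (Fin m → Fin N) → Fin r, ∃ z : Fin n → Fin N, qftp L (c ∘ z) = qftp L b ∧
      ∀ s t : Fin m → Fin n, qftp L (b ∘ s) = qftp L a → qftp L (b ∘ t) = qftp L a →
        χ (z ∘ s) = χ (z ∘ t)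

theorem TupleRP.of_isSemiRetract {L : FirstOrder.Language.{u, v}} {L' : FirstOrder.Language.{u', v'}}
    {A : Type w} {B : Type w'} [L.Structure A] [L'.Structure B] (hB : TupleRP L' B)
    (h : IsSemiRetract L L' A B) : TupleRP L A := by
  obtain ⟨g, f, -, -, hg, hf, e, he⟩ := h
  intro m n a b r
  obtain ⟨N, c, hc⟩ := hB m n (g ∘ a) (g ∘ b) r
  refine ⟨N, f ∘ c, fun χ => ?_⟩
  obtain ⟨z, hz, hχ⟩ := hc χ
  refine ⟨z, ?_, fun s t hs ht => hχ s t (hg _ _ _ hs) (hg _ _ _ ht)⟩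
  rw [Function.comp_assoc, hf _ _ _ hz, ← qftp_embedding e b]
  congr 1
  funext i
  exact (he _).symm

variable {L : FirstOrder.Language.{u, v}} {M : Type w} [L.Structure M]

theorem IsLocallyFinite.finite_of_embedding (h : IsLocallyFinite L M) {C : Type*} [L.Structure C]
    (hC : Structure.FG L C) (ε : C ↪[L] M) : Finite C :=
  have : Finite ε.toHom.range := h _ (hC.range ε.toHom)
  Finite.of_equiv _ ε.equivRange.toEquiv.symm

theorem closure_mem_age {n : ℕ} (a : Fin n → M) :
    (⟨Substructure.closure L (Set.range a), inferInstance⟩ : CategoryTheory.Bundled L.Structure) ∈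
      L.age M :=
  ⟨(Substructure.fg_iff_structure_fg _).1 (Substructure.fg_closure (Set.finite_range a)),
    ⟨Substructure.subtype _⟩⟩

theorem range_mem_copies {A C : Type*} [L.Structure A] [L.Structure C] (e : A ↪[L] C) :
    e.toHom.range ∈ copies L C A :=
  ⟨e.equivRange.symm⟩

/-- A copy of `A` gets the color of the tuple matching `a` under a chosen isomorphism. By rigidity
every embedding onto that copy yields the same tuple, so the choice is harmless. -/
theorem HasRP.tupleRP (hfin : IsLocallyFinite L M) (hord : IsOrderedStructure L M)
    (h : HasRP L M) : TupleRP L M := by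
  intro m n a b r
  set A := Substructure.closure L (Set.range a) with hA
  set B := Substructure.closure L (Set.range b) with hB
  let a' : Fin m → A := fun i => ⟨a i, Substructure.subset_closure ⟨i, rfl⟩⟩
  let b' : Fin n → B := fun i => ⟨b i, Substructure.subset_closure ⟨i, rfl⟩⟩
  have haa : qftp L a = qftp L a' := qftp_embedding A.subtype a'
  have hbb : qftp L b = qftp L b' := qftp_embedding B.subtype b'
  obtain ⟨C, ⟨hCfg, ⟨ε⟩⟩, hC⟩ := h _ (closure_mem_age (L := L) a) _ (closure_mem_age (L := L) b)
    -- RP speaks only of at least two colors; the spare ones cover `r < 2`.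
    (r + 2) (by omega)
  have : Finite C := hfin.finite_of_embedding hCfg ε
  have : Finite A := hfin _ (Substructure.fg_closure (Set.finite_range a))
  obtain ⟨N, ⟨c⟩⟩ := Finite.exists_equiv_fin C
  refine ⟨N, ε ∘ c.symm, fun χ => ?_⟩
  let ι (X : copies L C A) : X.1 ≃[L] A := X.2.some
  obtain ⟨B', ⟨τ⟩, hB'⟩ := hC fun X => Fin.castLE (by omega) (χ fun i => c ((ι X).symm (a' i)))
  let β : B ↪[L] C := B'.subtype.comp τ.symm.toEmbedding
  refine ⟨fun i => c (β (b' i)), ?_, ?_⟩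
  · rw [hbb, ← qftp_embedding (ε.comp β)]
    congr 1
    funext i
    simp
  · have key (s : Fin m → Fin n) (hs : qftp L (b ∘ s) = qftp L a) : ∃ X : copies L C A,
        X.1 ≤ B' ∧ ∀ i, ((ι X).symm (a' i) : C) = β (b' (s i)) := by
      have hs' : qftp L a' = qftp L (b' ∘ s) := by
        rw [← haa, ← hs]; exact qftp_comp hbb s
      obtain ⟨e, he⟩ := exists_embedding_of_qftp_eq hs' (closure_range_subtype_eq_top a)
      refine ⟨⟨(β.comp e).toHom.range, range_mem_copies (β.comp e)⟩, ?_, ?_⟩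
      · rintro _ ⟨x, rfl⟩
        exact (τ.symm (e x)).2
      · intro i
        have hr := embedding_eq_of_range_eq hord ε
          ((Substructure.subtype _).comp
            (ι ⟨(β.comp e).toHom.range, range_mem_copies (β.comp e)⟩).symm.toEmbedding)
          (β.comp e) ?_ (a' i)
        · rw [← Function.comp_apply (f := b'), ← he i]
          exact hr
        · ext x
          constructor
          · rintro ⟨y, rfl⟩
            exact ((ι ⟨(β.comp e).toHom.range, range_mem_copies (β.comp e)⟩).symm y).2
          · intro hx
            exact ⟨ι ⟨(β.comp e).toHom.range, range_mem_copies (β.comp e)⟩ ⟨x, hx⟩,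
              congrArg Subtype.val ((ι _).symm_apply_apply _)⟩
    intro s t hs ht
    obtain ⟨X, hX, hXs⟩ := key s hs
    obtain ⟨Y, hY, hYt⟩ := key t ht
    have := Fin.castLE_injective _ (hB' X Y hX hY)
    simp only [hXs, hYt] at this
    exact this

/-- With `A` and `B` enumerated completely, an index tuple gets the color of the copy of `A` it
enumerates; the copy is determined by its underlying set. -/
theorem TupleRP.hasRP (hfin : IsLocallyFinite L M) (h : TupleRP L M) : HasRP L M := by
  rintro A ⟨hAfg, ⟨εA⟩⟩ B ⟨hBfg, ⟨εB⟩⟩ r hr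
  have : Finite A := hfin.finite_of_embedding hAfg εA
  have : Finite B := hfin.finite_of_embedding hBfg εB
  obtain ⟨m, ⟨a⟩⟩ := Finite.exists_equiv_fin A
  obtain ⟨n, ⟨b⟩⟩ := Finite.exists_equiv_fin B
  obtain ⟨N, c, hc⟩ := h m n (εA ∘ a.symm) (εB ∘ b.symm) r
  let C := Substructure.closure L (Set.range c)
  refine ⟨_, closure_mem_age (L := L) c, fun (χ : copies L C A → Fin r) => ?_⟩
  let c' : Fin N → C := fun i => ⟨c i, Substructure.subset_closure ⟨i, rfl⟩⟩
  classical
  let χ' : (Fin m → Fin N) → Fin r := fun w =>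
    if hw : ∃ X : copies L C A, (X.1 : Set C) = Set.range (c' ∘ w) then χ hw.choose
    -- Never read: only tuples enumerating a copy are compared.
    else ⟨0, by omega⟩
  have hχ' (w : Fin m → Fin N) (X : copies L C A) (hX : (X.1 : Set C) = Set.range (c' ∘ w)) :
      χ' w = χ X := by
    have hw : ∃ X : copies L C A, (X.1 : Set C) = Set.range (c' ∘ w) := ⟨X, hX⟩
    simp only [χ', dif_pos hw]
    congr 1
    exact Subtype.ext (SetLike.coe_injective (hw.choose_spec.trans hX.symm))
  obtain ⟨z, hz, hmono⟩ := hc χ'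
  have hz' : qftp L b.symm = qftp L (c' ∘ z) := by
    rw [← qftp_embedding εB, ← hz, ← qftp_embedding C.subtype]
    rfl
  obtain ⟨β, hβ⟩ := exists_embedding_of_qftp_eq hz' (closure_range_equiv_eq_top b.symm)
  have key (X : copies L C A) (hX : X.1 ≤ β.toHom.range) : ∃ s : Fin m → Fin n,
      qftp L ((εB ∘ b.symm) ∘ s) = qftp L (εA ∘ a.symm) ∧ χ X = χ' (z ∘ s) := by
    obtain ⟨X, ⟨ι⟩⟩ := X
    have hs (i : Fin m) : ∃ j, β (b.symm j) = ι.symm (a.symm i) := by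
      obtain ⟨y, hy⟩ := hX (ι.symm (a.symm i)).2
      exact ⟨b y, by simpa using hy⟩
    choose s hs using hs
    refine ⟨s, ?_, (hχ' _ _ ?_).symm⟩
    · rw [qftp_embedding εA, Function.comp_assoc, qftp_embedding εB, ← qftp_embedding β,
        ← qftp_embedding (X.subtype.comp ι.symm.toEmbedding) a.symm]
      congr 1
      funext i
      exact hs i
    · ext x
      simp only [SetLike.mem_coe, Set.mem_range, Function.comp_apply]
      constructor
      · intro hx
        refine ⟨a (ι ⟨x, hx⟩), ?_⟩
        have := hβ (s (a (ι ⟨x, hx⟩)))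
        rw [hs] at this
        simpa using this.symm
      · rintro ⟨i, rfl⟩
        have := hβ (s i)
        rw [hs] at this
        rw [Function.comp_apply] at this
        rw [← this]
        exact (ι.symm (a.symm i)).2
  refine ⟨β.toHom.range, range_mem_copies β, fun X Y hX hY => ?_⟩
  obtain ⟨s, hs, hs'⟩ := key X hX
  obtain ⟨t, ht, ht'⟩ := key Y hY
  exact hs'.trans ((hmono s t hs ht).trans ht'.symm)

end Tuples

/-! ### Saturation, types in many variables, and definability -/

section Saturation

variable {L : FirstOrder.Language.{u, v}} {M : Type w} [L.Structure M]

/-- In a `κ`-saturated structure every finitely satisfiable set of formulas in finitely many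
variables over fewer than `κ` parameters is realized. -/
theorem IsSaturatedAt.exists_realize [Nonempty M] {κ : Cardinal.{w}} (h : IsSaturatedAt L M κ)
    {S : Set M} (hS : Cardinal.mk S < κ) {n : ℕ} (p : Set (L[[S]].Formula (Fin n)))
    (hp : ∀ F : Finset (L[[S]].Formula (Fin n)), ↑F ⊆ p → ∃ a : Fin n → M, ∀ φ ∈ F, φ.Realize a) :
    ∃ a : Fin n → M, ∀ φ ∈ p, φ.Realize a := by
  classical
  have hsat : (((L[[S]]).lhomWithConstants (Fin n)).onTheory (L[[S]].completeTheory M) ∪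
      Formula.equivSentence '' p).IsSatisfiable := by
    rw [Theory.isSatisfiable_iff_isFinitelySatisfiable]
    intro T₀ hT₀
    obtain ⟨a, ha⟩ := hp ((T₀.image Formula.equivSentence.symm).filter (· ∈ p))
      (fun φ hφ => (Finset.mem_filter.1 hφ).2)
    let _ : (constantsOn (Fin n)).Structure M := constantsOn.structure a
    have : M ⊨ (T₀ : L[[S]][[Fin n]].Theory) := by
      refine ⟨fun φ hφ => ?_⟩
      rcases hT₀ hφ with hφ' | ⟨ψ, hψ, rfl⟩
      · have : M ⊨ ((L[[S]]).lhomWithConstants (Fin n)).onTheory (L[[S]].completeTheory M) :=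
          (LHom.onTheory_model _ _).2 inferInstance
        exact this.realize_of_mem φ hφ'
      · refine (Formula.realize_equivSentence M ψ).2 (ha ψ ?_)
        simp only [Finset.mem_filter, Finset.mem_image]
        exact ⟨⟨_, hφ, by simp⟩, hψ⟩
    exact Theory.Model.isSatisfiable M
  have hne := mt (Theory.CompleteType.setOfPred_subset_eq_empty_iff
    (T := L[[S]].completeTheory M) (Formula.equivSentence '' p)).1 (not_not_intro hsat)
  obtain ⟨q, hq⟩ := Set.nonempty_iff_ne_empty.2 hne
  obtain ⟨a, ha⟩ := h S hS n q
  exact ⟨a, fun φ hφ => ha φ (hq ⟨φ, hφ, rfl⟩)⟩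

/-- Version with the parameters given by a family. -/
theorem IsSaturatedAt.exists_realize_sumElim [Nonempty M] {κ : Cardinal.{w}}
    (h : IsSaturatedAt L M κ) {I : Type w} (c : I → M) (hI : Cardinal.mk I < κ) {n : ℕ}
    (p : Set (L.Formula (I ⊕ Fin n)))
    (hp : ∀ F : Finset (L.Formula (I ⊕ Fin n)), ↑F ⊆ p →
      ∃ a : Fin n → M, ∀ φ ∈ F, φ.Realize (Sum.elim c a)) :
    ∃ a : Fin n → M, ∀ φ ∈ p, φ.Realize (Sum.elim c a) := by
  classical
  let S := Set.range c
  let d : I → S := Set.rangeFactorization c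
  let T : L.Formula (I ⊕ Fin n) → L[[S]].Formula (Fin n) := fun φ =>
    BoundedFormula.constantsVarsEquiv.symm (φ.relabel (Sum.map d id))
  have hT (φ : L.Formula (I ⊕ Fin n)) (a : Fin n → M) :
      (T φ).Realize a ↔ φ.Realize (Sum.elim c a) := by
    rw [Formula.Realize, ← BoundedFormula.realize_constantsVarsEquiv, Equiv.apply_symm_apply,
      ← Formula.Realize, Formula.realize_relabel]
    refine iff_of_eq (congrArg _ ?_)
    funext x
    rcases x with x | x <;> rfl
  obtain ⟨a, ha⟩ := h.exists_realize (Cardinal.mk_range_le.trans_lt hI) (T '' p) fun F hF => by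
    obtain ⟨F', hF', rfl⟩ := Finset.subset_set_image_iff.1 hF
    obtain ⟨a, ha⟩ := hp F' hF'
    refine ⟨a, fun φ hφ => ?_⟩
    obtain ⟨ψ, hψ, rfl⟩ := Finset.mem_image.1 hφ
    exact (hT ψ a).2 (ha ψ hψ)
  exact ⟨a, fun φ hφ => (hT φ a).1 (ha _ ⟨φ, hφ, rfl⟩)⟩

theorem exists_formula_fin {α : Type*} (φ : L.Formula α) :
    ∃ (n : ℕ) (x : Fin n → α) (ψ : L.Formula (Fin n)),
      ∀ v : α → M, ψ.Realize (v ∘ x) ↔ φ.Realize v := by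
  classical
  let e := (Fintype.equivFin φ.freeVarFinset)
  exact ⟨_, fun i => (e.symm i : α), BoundedFormula.restrictFreeVar φ e, fun v =>
    BoundedFormula.realize_restrictFreeVar v (by simp)⟩

open Filter in
/-- A saturated structure realizes the type in `M`-many variables given by any ultrafilter of
valuations. -/
theorem IsSaturated.exists_realize_of_ultrafilter (h : IsSaturated L M) (U : Ultrafilter (M → M)) :
    ∃ g : M → M, ∀ (n : ℕ) (x : Fin n → M) (φ : L.Formula (Fin n)),
      (∀ᶠ v : M → M in U, φ.Realize (v ∘ x)) → φ.Realize (g ∘ x) := by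
  classical
  rcases isEmpty_or_nonempty M with hM | hM
  · refine ⟨id, fun n x φ hφ => ?_⟩
    obtain ⟨v, hv⟩ := hφ.exists
    rwa [Subsingleton.elim (id ∘ x) (v ∘ x)]
  -- In the least order type of cardinality `|M|`, proper initial segments have fewer than `|M|`
  -- elements, so `g` can be built by recursion over them.
  obtain ⟨lo, wf, ho⟩ := Cardinal.exists_ord_eq_type_lt M
  let Good (α : M) (g : Set.Iio α → M) (y : M) : Prop :=
    ∀ φ : L.Formula (Set.Iio α ⊕ Fin 1),
      (∀ᶠ v : M → M in U, φ.Realize (Sum.elim (fun i => v i) (fun _ => v α))) →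
        φ.Realize (Sum.elim g fun _ => y)
  let step (α : M) (g : (β : M) → β < α → M) : M :=
    if hy : ∃ y, Good α (fun β => g β β.2) y then hy.choose else α
  let g : M → M := wf.wf.fix step
  have hg (α : M) (hy : ∃ y, Good α (fun β => g β) y) : Good α (fun β => g β) (g α) := by
    have : g α = hy.choose := by
      change wf.wf.fix step α = _
      rw [wf.wf.fix_eq]
      exact dif_pos hy
    rw [this]
    exact hy.choose_spec
  have hcard (α : M) : Cardinal.mk (Set.Iio α) < Cardinal.mk M :=
    Cardinal.mk_Iio_lt α ho
  have main (α : M) : ∀ (n : ℕ) (x : Fin n → M), (∀ i, x i ≤ α) → ∀ φ : L.Formula (Fin n),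
      (∀ᶠ v : M → M in U, φ.Realize (v ∘ x)) → φ.Realize (g ∘ x) := by
    induction α using wf.wf.induction with
    | h α ih =>
    have hlt (φ : L.Formula (Set.Iio α)) (hφ : ∀ᶠ v : M → M in U, φ.Realize fun i => v i) :
        φ.Realize fun i => g i := by
      obtain ⟨n, x, ψ, hψ⟩ := exists_formula_fin (M := M) φ
      simp only [← hψ] at hφ ⊢
      rcases isEmpty_or_nonempty (Fin n) with hn | hn
      · obtain ⟨v, hv⟩ := hφ.exists
        rwa [Subsingleton.elim ((fun i : Set.Iio α => g i) ∘ x) ((fun i : Set.Iio α => v i) ∘ x)]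
      · obtain ⟨i, hi⟩ := Finite.exists_max x
        exact ih _ (x i).2 n (fun j => x j) hi ψ hφ
    have hgood := hg α (by
      obtain ⟨y, hy⟩ := h.exists_realize_sumElim (fun i : Set.Iio α => g i) (hcard α)
        {φ : L.Formula (Set.Iio α ⊕ Fin 1) |
          ∀ᶠ v : M → M in U, φ.Realize (Sum.elim (fun i => v i) (fun _ => v α))} (fun F hF => by
          have hF' : ∀ᶠ v : M → M in U, ∀ φ : F,
              φ.1.Realize (Sum.elim (fun i : Set.Iio α => v i) (fun _ => v α)) :=
            eventually_all.2 fun φ => hF φ.2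
          -- Quantifying out the variable `α` leaves a formula about earlier values only, where the
          -- induction hypothesis applies.
          have := hlt ((Formula.iInf fun φ : F => φ.1).iExs (Fin 1)) (by
            filter_upwards [hF'] with v hv
            rw [Formula.realize_iExs]
            exact ⟨fun _ => v α, Formula.realize_iInf.2 hv⟩)
          obtain ⟨a, ha⟩ := Formula.realize_iExs.1 this
          exact ⟨a, fun φ hφ => Formula.realize_iInf.1 ha ⟨φ, hφ⟩⟩)
      refine ⟨y 0, fun φ hφ => ?_⟩
      convert hy φ hφ using 3 with i
      rw [Subsingleton.elim i 0])
    intro n x hx φ hφ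
    let ρ : Fin n → Set.Iio α ⊕ Fin 1 := fun i =>
      if hi : x i < α then Sum.inl ⟨x i, hi⟩ else Sum.inr 0
    have hρ (v : M → M) : Sum.elim (fun i : Set.Iio α => v i) (fun _ => v α) ∘ ρ = v ∘ x := by
      funext i
      by_cases hi : x i < α
      · simp [ρ, hi]
      · simp [ρ, le_antisymm (hx i) (not_lt.1 hi)]
    have := hgood (φ.relabel ρ)
    simp only [Formula.realize_relabel, hρ] at this
    exact this hφ
  refine ⟨g, fun n x φ hφ => ?_⟩
  rcases isEmpty_or_nonempty (Fin n) with hn | hn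
  · obtain ⟨v, hv⟩ := hφ.exists
    rwa [Subsingleton.elim (g ∘ x) (v ∘ x)]
  · obtain ⟨i, hi⟩ := Finite.exists_max x
    exact main (x i) n x hi φ hφ

/-- In a saturated structure, every finitely satisfiable family of formulas whose variables are
indexed by the structure is satisfiable. -/
theorem IsSaturated.exists_realize_family (h : IsSaturated L M) {ι : Type*} (n : ι → ℕ)
    (x : ∀ k, Fin (n k) → M) (φ : ∀ k, L.Formula (Fin (n k)))
    (hφ : ∀ F : Finset ι, ∃ v : M → M, ∀ k ∈ F, (φ k).Realize (v ∘ x k)) :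
    ∃ v : M → M, ∀ k, (φ k).Realize (v ∘ x k) := by
  classical
  choose V hV using hφ
  -- Along this ultrafilter each formula of the family holds eventually.
  let U : Ultrafilter (M → M) := Ultrafilter.of (Filter.atTop.map V)
  obtain ⟨g, hg⟩ := h.exists_realize_of_ultrafilter U
  refine ⟨g, fun k => hg _ _ _ ?_⟩
  refine Ultrafilter.of_le _ (Filter.mem_map.2 ?_)
  filter_upwards [Filter.eventually_ge_atTop {k}] with F hF
  exact hV F k (hF (Finset.mem_singleton_self k))

theorem qftp_eq_of_forall_realize {n : ℕ} {a b : Fin n → M} (h : ∀ ψ ∈ qftp L a, ψ.Realize b) :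
    qftp L a = qftp L b := by
  ext ψ
  refine ⟨fun hψ => ⟨hψ.1, h ψ hψ⟩, fun hψ => ⟨hψ.1, by_contra fun hn => ?_⟩⟩
  exact h _ ⟨hψ.1.not, hn⟩ hψ.2

/-- With infinitely many types, the negations of their defining formulas would be finitely
satisfiable, hence realized by a tuple that avoids its own type. -/
theorem finite_range_qftp (h : IsSaturated L M) (hqf : RealizedQFTypesDefinable L M) (n : ℕ) :
    (Set.range (qftp L : (Fin n → M) → _)).Finite := by
  classical
  rcases finite_or_infinite M with hM | hM
  · exact Set.finite_range _
  choose D hD using hqf n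
  by_contra hinf
  obtain ⟨b, hb⟩ := IsSaturatedAt.exists_realize_sumElim h (I := PEmpty.{w+1}) PEmpty.elim
    (by simp [pos_iff_ne_zero]) (Set.range fun a : Fin n → M => ((D a).relabel Sum.inr).not) (fun F hF => by
      rw [← Set.image_univ] at hF
      obtain ⟨A, -, rfl⟩ := Finset.subset_set_image_iff.1 hF
      by_contra hno
      push Not at hno
      refine hinf ((A.finite_toSet.image (qftp L)).subset ?_)
      rintro _ ⟨a, rfl⟩
      obtain ⟨φ, hφ, ha⟩ := hno a
      obtain ⟨a', ha', rfl⟩ := Finset.mem_image.1 hφ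
      refine ⟨a', ha', ?_⟩
      rw [Formula.realize_not, not_not, Formula.realize_relabel, hD] at ha
      exact qftp_eq_of_forall_realize ha)
  have := hb _ ⟨b, rfl⟩
  rw [Formula.realize_not, Formula.realize_relabel, hD] at this
  exact this fun ψ hψ => hψ.2

/-- A set of tuples that is invariant under equality of quantifier-free types is definable. -/
theorem exists_formula_of_invariant (h : IsSaturated L M) (hqf : RealizedQFTypesDefinable L M)
    {n : ℕ} (P : (Fin n → M) → Prop) (hP : ∀ a b, qftp L a = qftp L b → P a → P b) :
    ∃ φ : L.Formula (Fin n), ∀ a, φ.Realize a ↔ P a := by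
  choose D hD using hqf n
  let Q : Set (Set (L.Formula (Fin n))) := qftp L '' {a | P a}
  have : Finite Q := ((finite_range_qftp h hqf n).subset (Set.image_subset_range _ _)).to_subtype
  choose A hA using fun q : Q => q.2
  refine ⟨Formula.iSup fun q : Q => D (A q), fun a => ?_⟩
  rw [Formula.realize_iSup]
  constructor
  · rintro ⟨q, hq⟩
    exact hP _ _ (qftp_eq_of_forall_realize ((hD _ _).1 hq)) (hA q).1
  · intro ha
    refine ⟨⟨qftp L a, a, ha, rfl⟩, (hD _ _).2 fun ψ hψ => ?_⟩
    rw [(hA _).2] at hψ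
    exact hψ.2

end Saturation

/-! ### Homogeneous tuples and the construction of `g` -/

section Homogeneous

variable {LA : FirstOrder.Language.{u, v}} {LB : FirstOrder.Language.{u', v'}}
  {M : Type w} [LA.Structure M] [LB.Structure M]

/-- One pattern is treated at a time; homogeneity already obtained for the other patterns survives
passing to subtuples. -/
theorem TupleRP.exists_homogeneous (h : TupleRP LA M)
    (hfin : ∀ n, (Set.range (qftp LB : (Fin n → M) → _)).Finite) (l : List (Σ m, Fin m → M)) :
    ∀ {n : ℕ} (b : Fin n → M), ∃ b' : Fin n → M, qftp LA b' = qftp LA b ∧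
      ∀ a ∈ l, ∀ s t : Fin a.1 → Fin n, qftp LA (b ∘ s) = qftp LA a.2 →
        qftp LA (b ∘ t) = qftp LA a.2 → qftp LB (b' ∘ s) = qftp LB (b' ∘ t) := by
  induction l with
  | nil => exact fun b => ⟨b, rfl, by simp⟩
  | cons a l ih =>
    intro n b
    obtain ⟨m, a⟩ := a
    have := (hfin m).to_subtype
    obtain ⟨r, ⟨e⟩⟩ := Finite.exists_equiv_fin (Set.range (qftp LB : (Fin m → M) → _))
    obtain ⟨N, c, hc⟩ := h m n a b r
    obtain ⟨c', hc', hl⟩ := ih c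
    -- `c` was fixed before `c'`, yet the coloring reads types in `c'`; this is allowed because
    -- colorings live on indices.
    obtain ⟨z, hz, hχ⟩ := hc fun w => e ⟨qftp LB (c' ∘ w), _, rfl⟩
    refine ⟨c' ∘ z, (qftp_comp hc' z).trans hz, ?_⟩
    intro a' ha' s t hs ht
    rcases List.mem_cons.1 ha' with rfl | ha'
    · exact congrArg Subtype.val (e.injective (hχ s t hs ht))
    · exact hl a' ha' (z ∘ s) (z ∘ t) ((qftp_comp hz s).trans hs) ((qftp_comp hz t).trans ht)

/-- Both requirements on `g` depend only on `LB`-types, the second by the reduct hypothesis, so they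
are `LB`-definable and need checking only for finitely many pairs. -/
theorem TupleRP.exists_uniform_map (h : TupleRP LA M) (hred : IsQFReduct LA LB M)
    (hsat : IsSaturated LB M) (hqf : RealizedQFTypesDefinable LB M) :
    ∃ g : M → M, QFTypeRespecting LA LB g ∧
      ∀ (n : ℕ) (i : Fin n → M), qftp LA (g ∘ i) = qftp LA i := by
  classical
  let P (n : ℕ) (i : Fin n → M) (y : Fin (n + n) → M) : Prop :=
    qftp LB (y ∘ Fin.castAdd n) = qftp LB (y ∘ Fin.natAdd n) ∧
      qftp LA (y ∘ Fin.castAdd n) = qftp LA i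
  have hP (n : ℕ) (i : Fin n → M) : ∃ φ : LB.Formula (Fin (n + n)), ∀ y, φ.Realize y ↔ P n i y :=
    exists_formula_of_invariant hsat hqf _ fun y y' hy hPy =>
      ⟨(qftp_comp hy _).symm.trans (hPy.1.trans (qftp_comp hy _)),
        (hred _ _ _ (qftp_comp hy _)).symm.trans hPy.2⟩
  choose Φ hΦ using hP
  let I := Σ n : ℕ, {p : (Fin n → M) × (Fin n → M) // qftp LA p.1 = qftp LA p.2}
  have hcomp (v : M → M) (k : I) : P k.1 k.2.1.1 (v ∘ Fin.append k.2.1.1 k.2.1.2) ↔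
      qftp LB (v ∘ k.2.1.1) = qftp LB (v ∘ k.2.1.2) ∧ qftp LA (v ∘ k.2.1.1) = qftp LA k.2.1.1 := by
    have h₁ : Fin.append k.2.1.1 k.2.1.2 ∘ Fin.castAdd k.1 = k.2.1.1 :=
      funext fun q => Fin.append_left _ _ q
    have h₂ : Fin.append k.2.1.1 k.2.1.2 ∘ Fin.natAdd k.1 = k.2.1.2 :=
      funext fun q => Fin.append_right _ _ q
    simp only [P, Function.comp_assoc, h₁, h₂]
  obtain ⟨g, hg⟩ := hsat.exists_realize_family (ι := I) (fun k => k.1 + k.1)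
    (fun k => Fin.append k.2.1.1 k.2.1.2) (fun k => Φ k.1 k.2.1.1) (fun F => by
      let E : Set M := ⋃ k ∈ F, Set.range k.2.1.1 ∪ Set.range k.2.1.2
      have hE : E.Finite := F.finite_toSet.biUnion fun k _ =>
        (Set.finite_range _).union (Set.finite_range _)
      have := hE.to_subtype
      obtain ⟨n, ⟨e⟩⟩ := Finite.exists_equiv_fin E
      obtain ⟨b', hb', hl⟩ := h.exists_homogeneous (finite_range_qftp hsat hqf)
        (F.toList.map fun k => ⟨k.1, k.2.1.1⟩) (fun k => (e.symm k : M))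
      let v : M → M := fun x => if hx : x ∈ E then b' (e ⟨x, hx⟩) else x
      refine ⟨v, fun k hk => ?_⟩
      have hi (q) : k.2.1.1 q ∈ E := Set.mem_biUnion hk (Or.inl ⟨q, rfl⟩)
      have hj (q) : k.2.1.2 q ∈ E := Set.mem_biUnion hk (Or.inr ⟨q, rfl⟩)
      have hvi : v ∘ k.2.1.1 = b' ∘ fun q => e ⟨_, hi q⟩ := by
        funext q; simp [v, hi q]
      have hvj : v ∘ k.2.1.2 = b' ∘ fun q => e ⟨_, hj q⟩ := by
        funext q; simp [v, hj q]
      have hbi : (fun k => (e.symm k : M)) ∘ (fun q => e ⟨_, hi q⟩) = k.2.1.1 := by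
        funext q; simp
      have hbj : (fun k => (e.symm k : M)) ∘ (fun q => e ⟨_, hj q⟩) = k.2.1.2 := by
        funext q; simp
      rw [hΦ, hcomp, hvi, hvj]
      refine ⟨hl ⟨k.1, k.2.1.1⟩ (List.mem_map.2 ⟨k, Finset.mem_toList.2 hk, rfl⟩) _ _ ?_ ?_, ?_⟩
      · rw [hbi]
      · rw [hbj]; exact k.2.2.symm
      · rw [qftp_comp hb', hbi])
  have hg' (k : I) := (hcomp g k).1 ((hΦ _ _ _).1 (hg k))
  -- The diagonal pairs give preservation of `LA`-types.
  exact ⟨g, fun n i j hij => (hg' ⟨n, (i, j), hij⟩).1, fun n i => (hg' ⟨n, (i, i), rfl⟩).2⟩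

theorem exists_embedding_of_forall_qftp_eq {L : FirstOrder.Language.{u, v}} {A : Type w}
    {B : Type w'} [L.Structure A] [L.Structure B] (g : A → B)
    (hg : ∀ (n : ℕ) (i : Fin n → A), qftp L (g ∘ i) = qftp L i) : ∃ e : A ↪[L] B, ∀ x, e x = g x := by
  refine ⟨⟨⟨g, fun x y hxy => ?_⟩, fun {n} F x => ?_, fun {n} R x => ?_⟩, fun _ => rfl⟩
  · exact (eq_iff_of_qftp_eq (hg 2 ![x, y]) 0 1).1 hxy
  -- Appending the value to the arguments makes the function's graph visible to the type.
  · have := (realize_term_eq_iff_of_qftp_eq (hg (n + 1) (Fin.snoc x (Structure.funMap F x)))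
      (Term.var (Fin.last n)) (Term.func F fun i => Term.var i.castSucc)).2 (by simp)
    simpa [Function.comp_def] using this
  · exact relMap_iff_of_qftp_eq (hg n x) R Term.var

theorem TupleRP.isSemiRetract (h : TupleRP LA M) (hred : IsQFReduct LA LB M)
    (hsat : IsSaturated LB M) (hqf : RealizedQFTypesDefinable LB M) :
    IsSemiRetract LA LB M M := by
  obtain ⟨g, hg, hg'⟩ := h.exists_uniform_map hred hsat hqf
  obtain ⟨e, he⟩ := exists_embedding_of_forall_qftp_eq g hg'
  refine ⟨g, id, ?_, Function.injective_id, hg, hred, e, he⟩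
  rw [← funext he]
  exact e.injective

end Homogeneous

end SemiRetract

theorem mainTheorem5 {LA : FirstOrder.Language.{u, v}} {LB : FirstOrder.Language.{u', v'}}
    {M : Type w} [LA.Structure M] [LB.Structure M]
    (hAfin : SemiRetract.IsLocallyFinite LA M) (hBfin : SemiRetract.IsLocallyFinite LB M)
    (hAord : SemiRetract.IsOrderedStructure LA M) (hBord : SemiRetract.IsOrderedStructure LB M)
    (hred : SemiRetract.IsQFReduct LA LB M)
    (hsat : SemiRetract.IsSaturated LB M)
    (hqf : SemiRetract.RealizedQFTypesDefinable LB M)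
    (hRP : SemiRetract.HasRP LB M) :
    SemiRetract.IsSemiRetract LA LB M M ↔ SemiRetract.HasRP LA M :=
  ⟨fun h => ((hRP.tupleRP hBfin hBord).of_isSemiRetract h).hasRP hAfin,
    fun h => (h.tupleRP hAfin hAord).isSemiRetract hred hsat hqf⟩
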